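/- Let $V$ be a finite-dimensional real vector space, let $G$ be a connected Lie subgroup of $GL(V)$, and let $v\in V$. Let $Z(G)$ denote the Zariski closure of $G$ in $GL(V)$ and $Z(Gv)$ the Zariski closure of the orbit $Gv$ in $V$ (both for the Zariski topology defined by polynomial functions with real coefficients, that is, on real points). Let $\overline{Gv}$ be the closure of $Gv$ in the usual (metric) topology of $V$, and put $$\partial(Gv)=\overline{Gv}\smallsetminus Gv,\qquad \partial_Z(Gv)=Z(Gv)\smallsetminus Z(G)v .$$ Assume that $G$ is open in $Z(G)$ for the usual topology of $GL(V)$. Then $$\partial_Z(Gv)\cap\overline{Gv}=\partial(Gv).$$ Moreover $\partial(Gv)\subseteq\partial_Z(Gv)$ and $\partial_Z(Gv)\cap Gv=\emptyset$; in particular $\partial(Gv)\cap Z(G)v=\emptyset$. -/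

import Mathlib

namespace RealZariski

/-- The algebra of (real) polynomial functions on a real vector space `W`: the algebra of functions
generated by the linear forms on `W`. -/
def polynomialFunctions (W : Type*) [AddCommGroup W] [Module ℝ W] : Subalgebra ℝ (W → ℝ) :=
  Algebra.adjoin ℝ (Set.range fun (φ : Module.Dual ℝ W) (w : W) => φ w)

/-- The Zariski closed subsets of a real vector space `W`: common zero sets of polynomial
functions. -/
def IsZariskiClosed {W : Type*} [AddCommGroup W] [Module ℝ W] (Z : Set W) : Prop :=
  ∃ F : Set (W → ℝ), F ⊆ (polynomialFunctions W : Set (W → ℝ)) ∧ Z = {w | ∀ f ∈ F, f w = 0}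

/-- The Zariski closure of a subset of a real vector space: the intersection of all Zariski closed
sets that contain it. -/
def zariskiClosure {W : Type*} [AddCommGroup W] [Module ℝ W] (S : Set W) : Set W :=
  ⋂₀ {Z | IsZariskiClosed Z ∧ S ⊆ Z}

section Orbits

variable {V : Type*} [NormedAddCommGroup V] [NormedSpace ℝ V]

/-- The Zariski closed subsets of `GL(V)`, for the Zariski topology of `GL(V)` as a (principal)
open subset of the vector space `End(V)`. For finite-dimensional `V`, every linear endomorphism of
`V` is continuous, so `(V →L[ℝ] V)ˣ` is `GL(V)`, with its usual topology. -/
def IsZariskiClosedGL (Z : Set (V →L[ℝ] V)ˣ) : Prop :=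
  ∃ Y : Set (V →L[ℝ] V), IsZariskiClosed Y ∧ Z = {g : (V →L[ℝ] V)ˣ | (g : V →L[ℝ] V) ∈ Y}

/-- The Zariski closure in `GL(V)` of a subset of `GL(V)`. -/
def zariskiClosureGL (S : Set (V →L[ℝ] V)ˣ) : Set (V →L[ℝ] V)ˣ :=
  ⋂₀ {Z | IsZariskiClosedGL Z ∧ S ⊆ Z}

/-- `S v = {g v | g ∈ S}` for a subset `S` of `GL(V)`. -/
def orbitSet (S : Set (V →L[ℝ] V)ˣ) (v : V) : Set V :=
  {w | ∃ g ∈ S, w = (g : V →L[ℝ] V) v}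

/-- The metric boundary of the orbit: the closure of `G v` minus `G v`. -/
def metricBoundary (G : Subgroup (V →L[ℝ] V)ˣ) (v : V) : Set V :=
  closure (orbitSet (G : Set (V →L[ℝ] V)ˣ) v) \ orbitSet (G : Set (V →L[ℝ] V)ˣ) v

/-- The Zariski boundary of the orbit: `Z(G v) \ Z(G) v`. -/
def zariskiBoundary (G : Subgroup (V →L[ℝ] V)ˣ) (v : V) : Set V :=
  zariskiClosure (orbitSet (G : Set (V →L[ℝ] V)ˣ) v) \
    orbitSet (zariskiClosureGL (G : Set (V →L[ℝ] V)ˣ)) v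

end Orbits

end RealZariski

/-!
Let `Z` be the Zariski closure of `G v`. The theorem reduces to one fact: `G v` is open in `Z` for
the metric topology. Indeed, let `H` be the Zariski closure of `G`, a group that stabilizes `Z`.
If `h v` with `h ∈ H` is a limit of points of `G v`, then the neighbourhood `h G v` of `h v` in `Z`
meets `G v`, and since `G`, the identity component of `H`, is normal in `H`, this puts `h v` in
`G v` (`apply_mem_orbitSet_of_mem_closure`). The other assertions are formal.

That `G v` is open in `Z` (`orbitSet_mem_nhdsWithin`) combines an analytic and an algebraic
argument. Let `𝔥` be the Zariski tangent space of `H` at `1`.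

* For `X ∈ 𝔥` the left invariant vector field of `X` preserves the ideal of `H`, so `exp X ∈ H`
  (`exp_mem_zariskiClosure`). By the inverse function theorem a map into a Zariski closure
  whose differential is onto the Zariski tangent space covers a neighbourhood
  (`nhdsWithin_zariskiClosure_le_map`). Hence `G` is `exp 𝔥` near `1`, an identity theorem for
  polynomial functions holds on the connected group `G` (`eq_zero_of_eventually_eq_zero`), and the
  restrictions of polynomial functions to `G` form a domain. The same covering result, applied
  to the orbit map, shows that `G v` is open in `Z` as soon as the tangent space `T` of `Z` at `v`
  is `𝔥 v`.
* For the equality `T = 𝔥 v` (`exists_lie_apply_eq`), take linear forms `y j` on `V` that restrict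
  to a basis of the dual of `T`. By homogeneity they are algebraically independent as functions on
  `G v` (`eq_zero_of_eval_forms_eq_zero`). In characteristic zero there are derivations of the
  function field of `G` dual to the functions `g ↦ y j (g v)`
  (`exists_dual_derivations_of_domain`). After clearing denominators these are vector fields on
  `G`; at a suitable `g` they give `dim T` vectors of `g 𝔥` that the orbit map sends to independent
  vectors.
-/

namespace RealZariski

/-! ### Polynomial functions -/

section PolynomialFunctions

variable {W W' : Type*} [NormedAddCommGroup W] [NormedSpace ℝ W]
  [NormedAddCommGroup W'] [NormedSpace ℝ W']

lemma dual_mem_polynomialFunctions (φ : Module.Dual ℝ W) :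
    (fun w => φ w) ∈ polynomialFunctions W :=
  Algebra.subset_adjoin ⟨φ, rfl⟩

/-- Polynomial functions are stable under precomposition with linear maps. -/
lemma comp_linear_mem_polynomialFunctions (T : W →ₗ[ℝ] W') {f : W' → ℝ}
    (hf : f ∈ polynomialFunctions W') : (fun w => f (T w)) ∈ polynomialFunctions W := by
  induction hf using Algebra.adjoin_induction with
  | mem f hf =>
    obtain ⟨φ, rfl⟩ := hf
    exact dual_mem_polynomialFunctions (φ.comp T)
  | algebraMap r => exact (polynomialFunctions W).algebraMap_mem r
  | add f g _ _ hf hg => exact (polynomialFunctions W).add_mem hf hg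
  | mul f g _ _ hf hg => exact (polynomialFunctions W).mul_mem hf hg

variable [FiniteDimensional ℝ W]

lemma contDiff_of_mem_polynomialFunctions {f : W → ℝ} (hf : f ∈ polynomialFunctions W) :
    ContDiff ℝ ⊤ f := by
  induction hf using Algebra.adjoin_induction with
  | mem f hf =>
    obtain ⟨φ, rfl⟩ := hf
    exact (LinearMap.toContinuousLinearMap φ).contDiff
  | algebraMap r => exact contDiff_const
  | add f g _ _ hf hg => exact hf.add hg
  | mul f g _ _ hf hg => exact hf.mul hg

lemma differentiableAt_of_mem_polynomialFunctions {f : W → ℝ} (hf : f ∈ polynomialFunctions W)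
    (w : W) : DifferentiableAt ℝ f w :=
  (contDiff_of_mem_polynomialFunctions hf).differentiable (by simp) w

lemma continuous_of_mem_polynomialFunctions {f : W → ℝ} (hf : f ∈ polynomialFunctions W) :
    Continuous f :=
  (contDiff_of_mem_polynomialFunctions hf).continuous

/-- The derivative of a polynomial function along a polynomial vector field is polynomial. -/
lemma fderiv_field_mem_polynomialFunctions {T : W → W}
    (hT : ∀ φ : Module.Dual ℝ W, (fun w => φ (T w)) ∈ polynomialFunctions W) {f : W → ℝ}
    (hf : f ∈ polynomialFunctions W) :
    (fun w => fderiv ℝ f w (T w)) ∈ polynomialFunctions W := by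
  induction hf using Algebra.adjoin_induction with
  | mem f hf =>
    obtain ⟨φ, rfl⟩ := hf
    have h : (fun w => fderiv ℝ (fun w => φ w) w (T w)) = fun w => φ (T w) := by
      ext w
      rw [show (fun w => φ w) = LinearMap.toContinuousLinearMap φ from rfl,
        ContinuousLinearMap.fderiv]
      rfl
    rw [h]
    exact hT φ
  | algebraMap r =>
    have h : (fun w => fderiv ℝ (algebraMap ℝ (W → ℝ) r) w (T w)) = 0 := by
      ext w
      rw [show algebraMap ℝ (W → ℝ) r = fun _ => r from rfl]
      simp
    rw [h]
    exact zero_mem _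
  | add f g hf' hg' hf hg =>
    have h : (fun w => fderiv ℝ (f + g) w (T w)) =
        (fun w => fderiv ℝ f w (T w)) + fun w => fderiv ℝ g w (T w) := by
      ext w
      rw [fderiv_add (differentiableAt_of_mem_polynomialFunctions hf' w)
        (differentiableAt_of_mem_polynomialFunctions hg' w)]
      rfl
    rw [h]
    exact add_mem hf hg
  | mul f g hf' hg' hf hg =>
    have h : (fun w => fderiv ℝ (f * g) w (T w)) =
        f * (fun w => fderiv ℝ g w (T w)) + g * fun w => fderiv ℝ f w (T w) := by
      ext w
      rw [fderiv_mul (differentiableAt_of_mem_polynomialFunctions hf' w)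
        (differentiableAt_of_mem_polynomialFunctions hg' w)]
      rfl
    rw [h]
    exact add_mem (mul_mem hf' hg) (mul_mem hg' hf)

lemma fderiv_comp_linear {f : W → ℝ} (hf : f ∈ polynomialFunctions W) (T : W' →L[ℝ] W)
    (w u : W') : fderiv ℝ (fun w => f (T w)) w u = fderiv ℝ f (T w) (T u) := by
  have h := ((differentiableAt_of_mem_polynomialFunctions hf (T w)).hasFDerivAt.comp w
    T.hasFDerivAt).fderiv
  rw [show (fun w => f (T w)) = f ∘ T from rfl, h]
  rfl

instance finiteType_polynomialFunctions : Algebra.FiniteType ℝ (polynomialFunctions W) := by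
  rw [← Subalgebra.fg_iff_finiteType]
  classical
  let b := Module.finBasis ℝ (Module.Dual ℝ W)
  refine ⟨Finset.univ.image fun i => fun w => b i w, ?_⟩
  refine le_antisymm (Algebra.adjoin_mono ?_) (Algebra.adjoin_le ?_)
  · intro f hf
    obtain ⟨i, -, rfl⟩ := Finset.mem_image.1 (Finset.mem_coe.1 hf)
    exact ⟨b i, rfl⟩
  · rintro _ ⟨φ, rfl⟩
    have h : (fun w => φ w) = ∑ i, b.repr φ i • fun w => b i w := by
      ext w
      conv_lhs => rw [← b.sum_repr φ]
      simp [Finset.sum_apply, -Module.Basis.sum_repr]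
    change (fun w => φ w) ∈ _
    rw [h]
    refine Subalgebra.sum_mem _ fun i _ => Subalgebra.smul_mem _ (Algebra.subset_adjoin ?_) _
    simp

instance isNoetherianRing_polynomialFunctions : IsNoetherianRing (polynomialFunctions W) :=
  Algebra.FiniteType.isNoetherianRing ℝ _

end PolynomialFunctions

/-! ### Zariski closures -/

section ZariskiClosure

variable {W W' : Type*} [NormedAddCommGroup W] [NormedSpace ℝ W]
  [NormedAddCommGroup W'] [NormedSpace ℝ W']

lemma mem_zariskiClosure {S : Set W} {w : W} :
    w ∈ zariskiClosure S ↔ ∀ f ∈ polynomialFunctions W, (∀ s ∈ S, f s = 0) → f w = 0 := by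
  constructor
  · intro hw f hf hS
    have := hw {x | ∀ g ∈ ({f} : Set (W → ℝ)), g x = 0}
      ⟨⟨{f}, by simpa using hf, rfl⟩, fun s hs => by simpa using hS s hs⟩
    simpa using this
  · rintro h _ ⟨⟨F, hF, rfl⟩, hS⟩ f hf
    exact h f (hF hf) fun s hs => hS hs f hf

lemma subset_zariskiClosure (S : Set W) : S ⊆ zariskiClosure S :=
  fun _ hs => mem_zariskiClosure.2 fun _ _ h => h _ hs

lemma isZariskiClosed_zariskiClosure (S : Set W) : IsZariskiClosed (zariskiClosure S) :=
  ⟨{f | f ∈ polynomialFunctions W ∧ ∀ s ∈ S, f s = 0}, fun _ hf => hf.1, by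
    ext w
    simp [mem_zariskiClosure]⟩

/-- A linear map that sends `S` into the Zariski closure of `S'` does so with the Zariski closure
of `S`. -/
lemma mapsTo_zariskiClosure (T : W →ₗ[ℝ] W') {S : Set W} {S' : Set W'}
    (h : ∀ s ∈ S, T s ∈ zariskiClosure S') {w : W} (hw : w ∈ zariskiClosure S) :
    T w ∈ zariskiClosure S' :=
  mem_zariskiClosure.2 fun f hf hfS => mem_zariskiClosure.1 hw _
    (comp_linear_mem_polynomialFunctions T hf) fun s hs => mem_zariskiClosure.1 (h s hs) f hf hfS

variable [FiniteDimensional ℝ W]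

lemma isClosed_zariskiClosure (S : Set W) : IsClosed (zariskiClosure S) := by
  have : zariskiClosure S =
      ⋂ f ∈ {f | f ∈ polynomialFunctions W ∧ ∀ s ∈ S, f s = 0}, {w | f w = 0} := by
    ext w
    simp [mem_zariskiClosure]
  rw [this]
  exact isClosed_biInter fun f hf =>
    isClosed_eq (continuous_of_mem_polynomialFunctions hf.1) continuous_const

/-- A linear automorphism that maps a Zariski closure into itself maps it onto itself: the ideals
of the iterated images form an ascending chain, which is stationary. -/
lemma symm_mem_zariskiClosure (T : W ≃ₗ[ℝ] W) {S : Set W}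
    (h : ∀ s ∈ S, T s ∈ zariskiClosure S) {w : W} (hw : w ∈ zariskiClosure S) :
    T.symm w ∈ zariskiClosure S := by
  have hiter : ∀ n : ℕ, ∀ x ∈ zariskiClosure S, (T ^ n) x ∈ zariskiClosure S := by
    intro n
    induction n with
    | zero => exact fun x hx => hx
    | succ n ih =>
      intro x hx
      rw [pow_succ]
      exact ih _ (mapsTo_zariskiClosure T.toLinearMap h hx)
  let I : ℕ →o Ideal (polynomialFunctions W) :=
    { toFun := fun n =>
        { carrier := {f | ∀ x ∈ zariskiClosure S, f.1 ((T ^ n) x) = 0}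
          add_mem' := fun {f g} hf hg x hx => by
            change f.1 _ + g.1 _ = 0
            rw [hf x hx, hg x hx, add_zero]
          zero_mem' := fun x _ => rfl
          smul_mem' := fun c f hf x hx => by
            change c.1 _ * f.1 _ = 0
            rw [hf x hx, mul_zero] }
      monotone' := monotone_nat_of_le_succ fun n f hf x hx => by
        rw [pow_succ]
        exact hf _ (mapsTo_zariskiClosure T.toLinearMap h hx) }
  obtain ⟨n, hn⟩ := monotone_stabilizes_iff_noetherian.2
    (inferInstanceAs (IsNoetherian (polynomialFunctions W) (polynomialFunctions W))) I
  refine mem_zariskiClosure.2 fun f hf hfS => ?_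
  let g : polynomialFunctions W :=
    ⟨fun w => f ((T ^ (n + 1)).symm w), comp_linear_mem_polynomialFunctions
      (T ^ (n + 1)).symm.toLinearMap hf⟩
  have hg : g ∈ I (n + 1) := fun x hx => by
    change f ((T ^ (n + 1)).symm ((T ^ (n + 1)) x)) = 0
    rw [LinearEquiv.symm_apply_apply]
    exact mem_zariskiClosure.1 hx f hf hfS
  rw [← hn (n + 1) (Nat.le_succ n)] at hg
  have := hg w hw
  change f ((T ^ (n + 1)).symm ((T ^ n) w)) = 0 at this
  rwa [show (T ^ (n + 1)).symm ((T ^ n) w) = T.symm w by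
    rw [LinearEquiv.symm_apply_eq, pow_succ]
    simp [LinearEquiv.mul_apply]] at this

/-- The Zariski tangent space at `w` of the Zariski closure of `S`: the common kernel of the
differentials at `w` of the polynomial functions that vanish on `S`. -/
def zariskiTangent (S : Set W) (w : W) : Submodule ℝ W where
  carrier := {u | ∀ f ∈ polynomialFunctions W, (∀ s ∈ S, f s = 0) → fderiv ℝ f w u = 0}
  add_mem' hu hu' f hf hS := by rw [map_add, hu f hf hS, hu' f hf hS, add_zero]
  zero_mem' f _ _ := map_zero _
  smul_mem' c u hu f hf hS := by rw [map_smul, hu f hf hS, smul_zero]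

end ZariskiClosure

/-! ### Parametrizing a Zariski closure near a point -/

section LocalParametrization

open Filter Topology

variable {W : Type*} [NormedAddCommGroup W] [NormedSpace ℝ W] [FiniteDimensional ℝ W]

/-- Near `w`, the points of `zariskiClosure S` are separated by a linear projection onto the
tangent space: finitely many polynomial functions vanishing on `S` have differentials at `w` that
cut out the tangent space, and the inverse function theorem applies to them together with the
projection. -/
lemma exists_projection_injOn (S : Set W) (w : W) :
    ∃ π : W →L[ℝ] zariskiTangent S w, (∀ u : zariskiTangent S w, π u = u) ∧
      ∃ U ∈ 𝓝 w, Set.InjOn π (zariskiClosure S ∩ U) := by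
  have : CompleteSpace W := FiniteDimensional.complete ℝ W
  set T := zariskiTangent S w with hT
  obtain ⟨T', hT'⟩ := T.exists_isCompl
  let π : W →L[ℝ] T := LinearMap.toContinuousLinearMap (Submodule.projectionOnto T T' hT')
  have hπ : ∀ u : T, π u = u := fun u => Submodule.projectionOnto_apply_left hT' u
  refine ⟨π, hπ, ?_⟩
  -- the differentials at `w` of the functions vanishing on `S`
  let N : Submodule ℝ (Module.Dual ℝ W) :=
    { carrier := {l | ∃ f ∈ polynomialFunctions W, (∀ s ∈ S, f s = 0) ∧ ∀ u, fderiv ℝ f w u = l u}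
      add_mem' := by
        rintro l l' ⟨f, hf, hfS, hl⟩ ⟨g, hg, hgS, hl'⟩
        refine ⟨f + g, add_mem hf hg, fun s hs => by simp [hfS s hs, hgS s hs], fun u => ?_⟩
        rw [fderiv_add (differentiableAt_of_mem_polynomialFunctions hf w)
          (differentiableAt_of_mem_polynomialFunctions hg w)]
        simp [hl, hl']
      zero_mem' := ⟨0, zero_mem _, fun _ _ => rfl, fun u => by simp⟩
      smul_mem' := by
        rintro c l ⟨f, hf, hfS, hl⟩
        refine ⟨c • f, Subalgebra.smul_mem _ hf c, fun s hs => by simp [hfS s hs], fun u => ?_⟩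
        rw [fderiv_const_smul (differentiableAt_of_mem_polynomialFunctions hf w)]
        simp [hl] }
  have : Module.Free ℝ N := Module.Free.of_divisionRing ℝ N
  let b := Module.finBasis ℝ N
  choose f hf hfS hfb using fun i => (b i).2
  have hker : ∀ u, (∀ i, (b i : Module.Dual ℝ W) u = 0) → u ∈ T := by
    intro u hu g hg hgS
    let l : N := ⟨(fderiv ℝ g w).toLinearMap, g, hg, hgS, fun _ => rfl⟩
    change (l : Module.Dual ℝ W) u = 0
    rw [← b.sum_repr l]
    simp [hu, -Module.Basis.sum_repr]
  let F' : W →L[ℝ] (Fin (Module.finrank ℝ N) → ℝ) × T :=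
    (ContinuousLinearMap.pi fun i => fderiv ℝ (f i) w).prod π
  have hF' : LinearMap.ker F'.toLinearMap = ⊥ := by
    rw [LinearMap.ker_eq_bot']
    intro u hu
    have h1 : ∀ i, fderiv ℝ (f i) w u = 0 := fun i => congrFun (congrArg Prod.fst hu) i
    have h2 : π u = 0 := congrArg Prod.snd hu
    have huT : u ∈ T := hker u fun i => by rw [← hfb, h1]
    have := hπ ⟨u, huT⟩
    rw [h2] at this
    exact (congrArg Subtype.val this).symm
  obtain ⟨l, hl⟩ := F'.toLinearMap.exists_leftInverse_of_injective hF'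
  let Λ := LinearMap.toContinuousLinearMap l
  let Φ : W → W := fun x => Λ (fun i => f i x, π x)
  have hΦ : HasStrictFDerivAt Φ ((ContinuousLinearEquiv.refl ℝ W : W ≃L[ℝ] W) : W →L[ℝ] W) w := by
    have h1 : HasStrictFDerivAt (fun x => ((fun i => f i x, π x) : (Fin _ → ℝ) × T)) F' w :=
      HasStrictFDerivAt.prodMk (hasStrictFDerivAt_pi.2 fun i =>
        ((contDiff_of_mem_polynomialFunctions (hf i)).contDiffAt.hasStrictFDerivAt (by simp)))
        π.hasStrictFDerivAt
    have h2 := Λ.hasStrictFDerivAt.comp w h1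
    convert h2 using 1
    ext u
    exact (LinearMap.congr_fun hl u).symm
  refine ⟨(hΦ.toOpenPartialHomeomorph Φ).source,
    (hΦ.toOpenPartialHomeomorph Φ).open_source.mem_nhds
      hΦ.mem_toOpenPartialHomeomorph_source, ?_⟩
  rintro x ⟨hx, hxU⟩ y ⟨hy, hyU⟩ hxy
  refine (hΦ.toOpenPartialHomeomorph Φ).injOn hxU hyU ?_
  change Λ _ = Λ _
  have h0 : ∀ z ∈ zariskiClosure S, (fun i => f i z) = 0 := fun z hz => by
    ext i
    exact mem_zariskiClosure.1 hz _ (hf i) (hfS i)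
  rw [h0 x hx, h0 y hy, hxy]

/-- A differentiable map into a Zariski closure whose derivative maps onto the Zariski tangent
space covers a neighbourhood. -/
lemma nhdsWithin_zariskiClosure_le_map {M : Type*} [NormedAddCommGroup M] [NormedSpace ℝ M]
    [CompleteSpace M] {S : Set W} {w : W} {ψ : M → W} {ψ' : M →L[ℝ] W} {a : M}
    (hψ : HasStrictFDerivAt ψ ψ' a) (ha : ψ a = w)
    (hS : ∀ᶠ x in 𝓝 a, ψ x ∈ zariskiClosure S)
    (hT : ∀ u ∈ zariskiTangent S w, ∃ x, ψ' x = u) :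
    𝓝[zariskiClosure S] w ≤ map ψ (𝓝 a) := by
  obtain ⟨π, hπ, U, hU, hinj⟩ := exists_projection_injOn S w
  have : CompleteSpace W := FiniteDimensional.complete ℝ W
  have : CompleteSpace (zariskiTangent S w) := FiniteDimensional.complete ℝ _
  have hmap : map (fun x => π (ψ x)) (𝓝 a) = 𝓝 (π w) := by
    have hψπ : HasStrictFDerivAt (fun x => π (ψ x)) (π.comp ψ') a := π.hasStrictFDerivAt.comp a hψ
    rw [show π w = (fun x => π (ψ x)) a from (congrArg π ha).symm]
    refine hψπ.map_nhds_eq_of_surj ?_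
    rw [LinearMap.range_eq_top]
    intro t
    obtain ⟨x, hx⟩ := hT t t.2
    refine ⟨x, ?_⟩
    change π (ψ' x) = t
    rw [hx, hπ]
  intro s hs
  have hs' : {x | ψ x ∈ s ∧ ψ x ∈ zariskiClosure S ∧ ψ x ∈ U} ∈ 𝓝 a :=
    Filter.Eventually.and (Filter.mem_map.1 hs)
      (hS.and (hψ.continuousAt.eventually_mem (by rwa [ha])))
  have h1 : ∀ᶠ z in 𝓝 (π w), ∃ x, (ψ x ∈ s ∧ ψ x ∈ zariskiClosure S ∧ ψ x ∈ U) ∧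
      π (ψ x) = z := by
    rw [← hmap]
    exact Filter.mem_map.2 (Filter.mem_of_superset hs' fun x hx => ⟨x, hx, rfl⟩)
  have h2 : ∀ᶠ y in 𝓝[zariskiClosure S] w, ∃ x,
      (ψ x ∈ s ∧ ψ x ∈ zariskiClosure S ∧ ψ x ∈ U) ∧ π (ψ x) = π y :=
    (π.continuous.tendsto w).mono_left nhdsWithin_le_nhds |>.eventually h1
  filter_upwards [h2, self_mem_nhdsWithin, nhdsWithin_le_nhds hU] with y hy hyS hyU
  obtain ⟨x, ⟨hxs, hxS, hxU⟩, hxy⟩ := hy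
  rwa [← hinj ⟨hxS, hxU⟩ ⟨hyS, hyU⟩ hxy]

end LocalParametrization

/-! ### The exponential map and the identity theorem -/

section TangentMaps

variable {W W' : Type*} [NormedAddCommGroup W] [NormedSpace ℝ W]
  [NormedAddCommGroup W'] [NormedSpace ℝ W'] [FiniteDimensional ℝ W']

lemma map_mem_zariskiTangent (T : W →L[ℝ] W') {S : Set W} {S' : Set W'}
    (h : ∀ s ∈ S, T s ∈ S') {w u : W} (hu : u ∈ zariskiTangent S w) :
    T u ∈ zariskiTangent S' (T w) := fun f hf hfS => by
  rw [← fderiv_comp_linear hf]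
  exact hu _ (comp_linear_mem_polynomialFunctions T.toLinearMap hf) fun s hs => hfS _ (h s hs)

end TangentMaps

section Exponential

open Filter Topology

variable {A : Type*} [NormedRing A] [NormedAlgebra ℝ A] [FiniteDimensional ℝ A]

/-- The Lie algebra of the Zariski closure of a group `G` of units of an algebra: the Zariski
tangent space at `1`. -/
noncomputable abbrev zariskiLie (G : Subgroup Aˣ) : Submodule ℝ A :=
  zariskiTangent (Units.val '' (G : Set Aˣ)) 1

lemma mul_mem_zariskiTangent {G : Subgroup Aˣ} {g : Aˣ} (hg : g ∈ G) {x u : A}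
    (hu : u ∈ zariskiTangent (Units.val '' (G : Set Aˣ)) x) :
    g * u ∈ zariskiTangent (Units.val '' (G : Set Aˣ)) (g * x) := by
  refine map_mem_zariskiTangent (ContinuousLinearMap.mul ℝ A g) ?_ hu
  rintro _ ⟨h, hh, rfl⟩
  exact ⟨g * h, G.mul_mem hg hh, rfl⟩

lemma analyticOnNhd_exp_smul {f : A → ℝ} (hf : f ∈ polynomialFunctions A) (a X : A) :
    AnalyticOnNhd ℝ (fun t : ℝ => f (a * NormedSpace.exp (t • X))) Set.univ := by
  have : CompleteSpace A := FiniteDimensional.complete ℝ A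
  have h1 : AnalyticOnNhd ℝ (fun t : ℝ => t • X) Set.univ :=
    (ContinuousLinearMap.smulRight (ContinuousLinearMap.id ℝ ℝ) X).analyticOnNhd _
  have h2 : AnalyticOnNhd ℝ (NormedSpace.exp : A → A) Set.univ := fun x _ =>
    NormedSpace.exp_analytic (𝕂 := ℝ) x
  have h3 : AnalyticOnNhd ℝ (fun x : A => f (a * x)) Set.univ :=
    (contDiff_of_mem_polynomialFunctions (comp_linear_mem_polynomialFunctions
      (LinearMap.mulLeft ℝ a) hf)).analyticOnNhd
  exact h3.comp (h2.comp h1 (Set.mapsTo_univ _ _)) (Set.mapsTo_univ _ _)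

/-- The exponential map sends the Lie algebra into the Zariski closure of the group: the left
invariant vector field of `X` preserves the ideal of functions vanishing on `G`, so that for every
such `f` all derivatives of `t ↦ f (exp (t X))` vanish at `0`. -/
lemma exp_mem_zariskiClosure {G : Subgroup Aˣ} {X : A} (hX : X ∈ zariskiLie G) :
    NormedSpace.exp X ∈ zariskiClosure (Units.val '' (G : Set Aˣ)) := by
  have : CompleteSpace A := FiniteDimensional.complete ℝ A
  refine mem_zariskiClosure.2 fun f hf hfG => ?_
  let D : (A → ℝ) → A → ℝ := fun f x => fderiv ℝ f x (x * X)
  have hD : ∀ n : ℕ, D^[n] f ∈ polynomialFunctions A ∧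
      ∀ s ∈ Units.val '' (G : Set Aˣ), (D^[n] f) s = 0 := by
    intro n
    induction n with
    | zero => exact ⟨hf, hfG⟩
    | succ n ih =>
      rw [Function.iterate_succ_apply']
      refine ⟨fderiv_field_mem_polynomialFunctions
        (fun φ => dual_mem_polynomialFunctions (φ.comp (LinearMap.mulRight ℝ X))) ih.1, ?_⟩
      rintro _ ⟨g, hg, rfl⟩
      have := mul_mem_zariskiTangent hg hX _ ih.1 ih.2
      rwa [mul_one] at this
  have hderiv : ∀ n : ℕ, iteratedDeriv n (fun t : ℝ => f (NormedSpace.exp (t • X))) =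
      fun t : ℝ => (D^[n] f) (NormedSpace.exp (t • X)) := by
    intro n
    induction n with
    | zero => simp
    | succ n ih =>
      rw [iteratedDeriv_succ, ih, Function.iterate_succ_apply']
      ext t
      exact ((differentiableAt_of_mem_polynomialFunctions (hD n).1 _).hasFDerivAt.comp_hasDerivAt t
        (hasDerivAt_exp_smul_const (𝕂 := ℝ) X t)).deriv
  have han : AnalyticOnNhd ℝ (fun t : ℝ => f (NormedSpace.exp (t • X))) Set.univ := by
    simpa using analyticOnNhd_exp_smul hf 1 X
  have hev : ∀ᶠ t : ℝ in 𝓝 0, f (NormedSpace.exp (t • X)) = 0 := by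
    rw [← analyticOrderAt_eq_top, ENat.eq_top_iff_forall_ge]
    intro n
    rw [natCast_le_analyticOrderAt_iff_iteratedDeriv_eq_zero (han 0 (Set.mem_univ _))]
    intro i _
    rw [hderiv]
    simp only [zero_smul, NormedSpace.exp_zero]
    exact (hD i).2 1 ⟨1, G.one_mem, rfl⟩
  have h0 := han.eqOn_zero_of_preconnected_of_eventuallyEq_zero isPreconnected_univ
    (Set.mem_univ 0) hev (Set.mem_univ 1)
  simpa using h0

variable {G : Subgroup Aˣ}

lemma tendsto_exp_subtype (𝔥 : Submodule ℝ A) :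
    Tendsto (fun X : 𝔥 => NormedSpace.exp (X : A)) (𝓝 0) (𝓝 1) := by
  have : CompleteSpace A := FiniteDimensional.complete ℝ A
  have h := ((NormedSpace.exp_analytic (𝕂 := ℝ) (0 : A)).continuousAt).tendsto
  rw [NormedSpace.exp_zero] at h
  exact h.comp (continuous_subtype_val.tendsto' (0 : 𝔥) 0 rfl)

lemma hasStrictFDerivAt_exp_subtype (𝔥 : Submodule ℝ A) :
    HasStrictFDerivAt (fun X : 𝔥 => NormedSpace.exp (X : A)) 𝔥.subtypeL 0 := by
  have : CompleteSpace A := FiniteDimensional.complete ℝ A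
  have h : HasStrictFDerivAt (NormedSpace.exp : A → A) (1 : A →L[ℝ] A) (𝔥.subtypeL 0) := by
    rw [map_zero]
    exact hasStrictFDerivAt_exp_zero
  exact h.comp (0 : 𝔥) 𝔥.subtypeL.hasStrictFDerivAt

variable (hG : ∀ᶠ x in 𝓝[zariskiClosure (Units.val '' (G : Set Aˣ))] (1 : A),
  x ∈ Units.val '' (G : Set Aˣ))

include hG in
lemma eventually_exp_mem :
    ∀ᶠ X : zariskiLie G in 𝓝 0, NormedSpace.exp (X : A) ∈ Units.val '' (G : Set Aˣ) :=
  (tendsto_nhdsWithin_iff.2 ⟨tendsto_exp_subtype _,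
    Eventually.of_forall fun X => exp_mem_zariskiClosure X.2⟩).eventually hG

/-- A group that is open in its Zariski closure is, near `1`, covered by the exponential map. -/
lemma nhdsWithin_one_le_map_exp :
    𝓝[zariskiClosure (Units.val '' (G : Set Aˣ))] (1 : A) ≤
      map (fun X : zariskiLie G => NormedSpace.exp (X : A)) (𝓝 0) := by
  have : CompleteSpace (zariskiLie G) := FiniteDimensional.complete ℝ _
  exact nhdsWithin_zariskiClosure_le_map (hasStrictFDerivAt_exp_subtype _)
    (by simp) (Eventually.of_forall fun X => exp_mem_zariskiClosure X.2) fun u hu => ⟨⟨u, hu⟩, rfl⟩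

lemma eventually_eq_mul_exp (g : G) : ∀ᶠ p : G × G in 𝓝 (g, g),
    ∃ X ∈ zariskiLie G, ((p.2 : Aˣ) : A) = (p.1 : Aˣ) * NormedSpace.exp X := by
  have h1 : ∀ᶠ x in 𝓝[zariskiClosure (Units.val '' (G : Set Aˣ))] (1 : A),
      ∃ X ∈ zariskiLie G, NormedSpace.exp X = x :=
    nhdsWithin_one_le_map_exp (Filter.mem_map.2 (univ_mem' fun X => ⟨X, X.2, rfl⟩))
  have h2 : Tendsto (fun p : G × G => (((p.1⁻¹ * p.2 : G) : Aˣ) : A)) (𝓝 (g, g))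
      (𝓝[zariskiClosure (Units.val '' (G : Set Aˣ))] (1 : A)) := by
    refine tendsto_nhdsWithin_iff.2 ⟨?_, Eventually.of_forall fun p =>
      subset_zariskiClosure _ ⟨_, (p.1⁻¹ * p.2).2, rfl⟩⟩
    have hc : Continuous fun p : G × G => (((p.1⁻¹ * p.2 : G) : Aˣ) : A) :=
      Units.continuous_val.comp (continuous_subtype_val.comp (by fun_prop))
    exact hc.tendsto' _ _ (by simp)
  filter_upwards [h2.eventually h1] with p ⟨X, hX, hp⟩
  refine ⟨X, hX, ?_⟩
  rw [hp]
  simp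

include hG in
/-- The identity theorem: on a connected group that is open in its Zariski closure, a polynomial
function that vanishes near one point vanishes. -/
lemma eq_zero_of_eventually_eq_zero [PreconnectedSpace G] {f : A → ℝ}
    (hf : f ∈ polynomialFunctions A) {g : G} (hg : ∀ᶠ x : G in 𝓝 g, f (x : Aˣ) = 0) (x : G) :
    f (x : Aˣ) = 0 := by
  have : CompleteSpace A := FiniteDimensional.complete ℝ A
  let U : Set G := {y | ∀ᶠ z : G in 𝓝 y, f (z : Aˣ) = 0}
  have hU : IsClopen U := by
    refine ⟨isClosed_of_closure_subset fun y hy => ?_, isOpen_setOfPred_eventually_nhds⟩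
    obtain ⟨N, hN, hNN⟩ := mem_prod_same_iff.1 (nhds_prod_eq (x := y) (y := y) ▸
      eventually_eq_mul_exp y)
    obtain ⟨z, hzN, hzU⟩ := mem_closure_iff_nhds.1 hy N hN
    filter_upwards [hN] with t ht
    obtain ⟨X, hX, htX⟩ := hNN (Set.mk_mem_prod hzN ht)
    -- `f` vanishes along the line `s ↦ z * exp (s X)`, as it does so for small `s`
    have hline : ∀ᶠ s : ℝ in 𝓝 0, f ((z : Aˣ) * NormedSpace.exp (s • X)) = 0 := by
      have h1 : Tendsto (fun s : ℝ => s • (⟨X, hX⟩ : zariskiLie G)) (𝓝 0) (𝓝 0) :=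
        Continuous.tendsto' (by fun_prop) _ _ (zero_smul ℝ _)
      have h2 : Tendsto (fun x : G => (((z * x : G) : Aˣ) : A)) (𝓝 1) (𝓝 ((z : Aˣ) : A)) :=
        Continuous.tendsto' (Units.continuous_val.comp
          (continuous_subtype_val.comp (by fun_prop))) _ _ (by simp)
      -- the topology of `G` is induced from that of `A`
      have hemb : IsEmbedding fun x : G => ((x : Aˣ) : A) :=
        Units.isOpenEmbedding_val.isEmbedding.comp .subtypeVal
      have hz : {x : G | f (x : Aˣ) = 0} ∈ 𝓝 z := hzU
      rw [hemb.isInducing.nhds_eq_comap z] at hz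
      obtain ⟨O, hO, hOz⟩ := hz
      have h3 : ∀ᶠ s : ℝ in 𝓝 0, ((z : Aˣ) : A) * NormedSpace.exp (s • X) ∈ O := by
        have hc : ContinuousAt (fun s : ℝ => ((z : Aˣ) : A) * NormedSpace.exp (s • X)) 0 :=
          continuousAt_const.mul
            (hasDerivAt_exp_smul_const (𝕂 := ℝ) X 0).continuousAt
        exact hc.eventually_mem (by simpa using hO)
      filter_upwards [h1.eventually (eventually_exp_mem hG), h3] with s ⟨y, hyG, hy⟩ hsO
      change (y : A) = NormedSpace.exp (s • X) at hy
      rw [← hy] at hsO ⊢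
      exact hOz (show (((z * ⟨y, hyG⟩ : G) : Aˣ) : A) ∈ O from hsO)
    have := (analyticOnNhd_exp_smul hf (z : Aˣ) X).eqOn_zero_of_preconnected_of_eventuallyEq_zero
      isPreconnected_univ (Set.mem_univ 0) hline (Set.mem_univ 1)
    rw [htX]
    simpa using this
  have : x ∈ U := by
    rw [hU.eq_univ ⟨g, hg⟩]
    trivial
  exact this.self_of_nhds

include hG in
/-- The restrictions of polynomial functions to `G` form a domain. -/
lemma eq_zero_or_eq_zero_of_mul_eq_zero [PreconnectedSpace G] {f₁ f₂ : A → ℝ}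
    (hf₁ : f₁ ∈ polynomialFunctions A) (hf₂ : f₂ ∈ polynomialFunctions A)
    (h : ∀ x : G, f₁ (x : Aˣ) * f₂ (x : Aˣ) = 0) :
    (∀ x : G, f₁ (x : Aˣ) = 0) ∨ ∀ x : G, f₂ (x : Aˣ) = 0 := by
  by_contra! hcon
  obtain ⟨⟨g, hg⟩, ⟨g', hg'⟩⟩ := hcon
  refine hg' (eq_zero_of_eventually_eq_zero hG hf₂ (g := g) ?_ g')
  have hc : Continuous fun x : G => f₁ (x : Aˣ) :=
    (continuous_of_mem_polynomialFunctions hf₁).comp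
      (Units.continuous_val.comp continuous_subtype_val)
  filter_upwards [hc.continuousAt.eventually_ne hg] with x hx
  exact (mul_eq_zero.1 (h x)).resolve_left hx

end Exponential

/-! ### Extension of derivations and algebraic independence -/

section Algebra

open scoped TensorProduct

/-- In characteristic zero, a derivation of a subring of a finitely generated field extension
extends to the field, which is formally smooth over the subring. -/
lemma exists_derivation_extension {k P L : Type*} [Field k] [CommRing P] [Algebra k P]
    [Field L] [CharZero L] [Algebra k L] [Algebra P L] [IsScalarTower k P L] [FaithfulSMul P L]
    [Algebra.EssFiniteType k L] (δ : Derivation k P L) :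
    ∃ δ' : Derivation k L L, ∀ p, δ' (algebraMap P L p) = δ p := by
  have := IsDomain.of_faithfulSMul P L
  let : Algebra (FractionRing P) L := FractionRing.liftAlgebra P L
  have : IsScalarTower P (FractionRing P) L := FractionRing.isScalarTower_liftAlgebra P L
  have : IsScalarTower k (FractionRing P) L := IsScalarTower.of_algebraMap_eq fun x => by
    rw [IsScalarTower.algebraMap_apply k P (FractionRing P),
      ← IsScalarTower.algebraMap_apply P (FractionRing P) L, ← IsScalarTower.algebraMap_apply k P L]
  have : Algebra.EssFiniteType (FractionRing P) L := Algebra.EssFiniteType.of_comp k _ L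
  have : CharZero (FractionRing P) :=
    (algebraMap (FractionRing P) L).charZero
  have : Algebra.FormallySmooth P (FractionRing P) :=
    .of_isLocalization (nonZeroDivisors P)
  have : Algebra.FormallySmooth P L := .comp _ (FractionRing P) _
  have hinj : Function.Injective (KaehlerDifferential.mapBaseChange k P L) := by
    rw [injective_iff_map_eq_zero]
    intro x hx
    obtain ⟨y, rfl⟩ := (Algebra.H1Cotangent.exact_δ_mapBaseChange k P L x).1 hx
    rw [Subsingleton.elim y 0, map_zero]
  obtain ⟨r, hr⟩ := (KaehlerDifferential.mapBaseChange k P L).exists_leftInverse_of_injective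
    (LinearMap.ker_eq_bot.2 hinj)
  refine ⟨((δ.liftKaehlerDifferential.liftBaseChange L).comp r).compDer
    (KaehlerDifferential.D k L), fun p => ?_⟩
  have h := LinearMap.congr_fun hr (1 ⊗ₜ KaehlerDifferential.D k P p)
  simp only [LinearMap.comp_apply, KaehlerDifferential.mapBaseChange_tmul, one_smul,
    KaehlerDifferential.map_D, LinearMap.id_apply] at h
  change δ.liftKaehlerDifferential.liftBaseChange L (r (KaehlerDifferential.D k L _)) = _
  rw [h]
  simp

/-- Algebraically independent elements of a finitely generated field extension of characteristic
zero admit dual derivations. -/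
lemma exists_dual_derivations {k L ι : Type*} [Field k] [Field L] [CharZero L] [Algebra k L]
    [Algebra.EssFiniteType k L] [DecidableEq ι] {y : ι → L} (hy : AlgebraicIndependent k y) (i : ι) :
    ∃ δ : Derivation k L L, ∀ j, δ (y j) = if j = i then 1 else 0 := by
  let : Algebra (MvPolynomial ι k) L := (MvPolynomial.aeval y).toAlgebra
  have : IsScalarTower k (MvPolynomial ι k) L :=
    IsScalarTower.of_algebraMap_eq fun x => ((MvPolynomial.aeval y).commutes x).symm
  have : FaithfulSMul (MvPolynomial ι k) L := (faithfulSMul_iff_algebraMap_injective _ _).2 hy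
  obtain ⟨δ, hδ⟩ := exists_derivation_extension (L := L)
    ((Algebra.linearMap (MvPolynomial ι k) L).compDer (MvPolynomial.pderiv i))
  refine ⟨δ, fun j => ?_⟩
  have h1 : algebraMap (MvPolynomial ι k) L (MvPolynomial.X j) = y j := MvPolynomial.aeval_X y j
  rw [← h1, hδ]
  change algebraMap (MvPolynomial ι k) L (MvPolynomial.pderiv i (MvPolynomial.X j)) = _
  rw [MvPolynomial.pderiv_X]
  by_cases h : j = i
  · subst h
    simp
  · simp [h]

/-- Algebraically independent elements of a finitely generated domain of characteristic zero admit
derivations of the domain that are dual to them up to a common factor `c`, which clears the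
denominators of dual derivations of the field of fractions. -/
lemma exists_dual_derivations_of_domain {k R ι : Type*} [Field k] [CommRing R] [IsDomain R]
    [CharZero R] [Algebra k R] [Algebra.FiniteType k R] [Finite ι] [DecidableEq ι] {y : ι → R}
    (hy : AlgebraicIndependent k y) :
    ∃ c : R, c ≠ 0 ∧ ∃ D : ι → Derivation k R R, ∀ i j, D i (y j) = if j = i then c else 0 := by
  let L := FractionRing R
  have : Algebra.EssFiniteType k L := .comp k R L
  have hinj : Function.Injective (algebraMap R L) := IsFractionRing.injective R L
  have : CharZero L := charZero_of_injective_algebraMap hinj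
  have hind : AlgebraicIndependent k fun i => algebraMap R L (y i) :=
    hy.map' (f := IsScalarTower.toAlgHom k R L) hinj
  choose δ hδ using exists_dual_derivations hind
  obtain ⟨s, hs⟩ := (Algebra.FiniteType.out : (⊤ : Subalgebra k R).FG)
  obtain ⟨c, hc⟩ := IsLocalization.exist_integer_multiples_of_finite (nonZeroDivisors R)
    fun p : ι × s => δ p.1 (algebraMap R L p.2)
  have hint : ∀ i r, ∃ r' : R, algebraMap R L r' = algebraMap R L c * δ i (algebraMap R L r) := by
    intro i r
    have hr : r ∈ Algebra.adjoin k (s : Set R) := hs ▸ Algebra.mem_top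
    induction hr using Algebra.adjoin_induction with
    | mem r hr =>
      obtain ⟨r', hr'⟩ := hc (i, ⟨r, hr⟩)
      exact ⟨r', by rw [hr', Algebra.smul_def]⟩
    | algebraMap a =>
      refine ⟨0, ?_⟩
      rw [← IsScalarTower.algebraMap_apply k R L, Derivation.map_algebraMap, mul_zero, map_zero]
    | add r₁ r₂ _ _ h₁ h₂ =>
      obtain ⟨⟨a₁, h₁⟩, a₂, h₂⟩ := And.intro h₁ h₂
      exact ⟨a₁ + a₂, by rw [map_add, map_add, map_add, h₁, h₂, mul_add]⟩
    | mul r₁ r₂ _ _ h₁ h₂ =>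
      obtain ⟨⟨a₁, h₁⟩, a₂, h₂⟩ := And.intro h₁ h₂
      refine ⟨r₁ * a₂ + r₂ * a₁, ?_⟩
      rw [map_add, map_mul, map_mul, map_mul, Derivation.leibniz, h₁, h₂, smul_eq_mul, smul_eq_mul]
      ring
  choose d hd using hint
  refine ⟨c, nonZeroDivisors.coe_ne_zero c, fun i => Derivation.mk'
    { toFun := d i
      map_add' := fun r₁ r₂ => hinj (by rw [map_add, hd, hd, hd, map_add, map_add, mul_add])
      map_smul' := fun a r => hinj (by
        rw [hd, RingHom.id_apply, Algebra.smul_def, Algebra.smul_def, map_mul (algebraMap R L),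
          map_mul (algebraMap R L), hd,
          ← IsScalarTower.algebraMap_apply k R L, Derivation.leibniz,
          Derivation.map_algebraMap, smul_eq_mul, smul_zero, add_zero]
        ring) } fun r₁ r₂ => hinj ?_, fun i j => hinj ?_⟩
  · change algebraMap R L (d i (r₁ * r₂)) = algebraMap R L (r₁ * d i r₂ + r₂ * d i r₁)
    rw [hd, map_add, map_mul (algebraMap R L), map_mul (algebraMap R L), map_mul (algebraMap R L),
      Derivation.leibniz, hd, hd, smul_eq_mul, smul_eq_mul]
    ring
  · change algebraMap R L (d i (y j)) = _
    rw [hd, hδ]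
    split_ifs <;> simp

lemma totalDegree_pderiv_lt {σ R : Type*} [CommSemiring R] {q : MvPolynomial σ R} (i : σ)
    (hq : q.totalDegree ≠ 0) : (MvPolynomial.pderiv i q).totalDegree < q.totalDegree := by
  rw [MvPolynomial.totalDegree, Finset.sup_lt_iff (Nat.pos_of_ne_zero hq)]
  intro m hm
  rw [MvPolynomial.mem_support_iff, MvPolynomial.coeff_pderiv] at hm
  have h := MvPolynomial.le_totalDegree (MvPolynomial.mem_support_iff.2 (left_ne_zero_of_mul hm))
  rw [Finsupp.sum_add_index' (by simp) (by simp)] at h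
  simpa using h

lemma totalDegree_eq_zero_of_pderiv_eq_zero {σ R : Type*} [CommRing R] [IsDomain R] [CharZero R]
    {q : MvPolynomial σ R} (hq : ∀ i, MvPolynomial.pderiv i q = 0) : q.totalDegree = 0 := by
  rw [MvPolynomial.totalDegree_eq_zero_iff]
  intro m hm i
  by_contra hmi
  have h := MvPolynomial.coeff_pderiv (i := i) q (m - Finsupp.single i 1)
  rw [hq, MvPolynomial.coeff_zero, tsub_add_cancel_of_le
    (Finsupp.single_le_iff.2 (Nat.one_le_iff_ne_zero.2 hmi))] at h
  refine mul_ne_zero (MvPolynomial.mem_support_iff.1 hm) ?_ h.symm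
  exact Nat.cast_add_one_ne_zero _

end Algebra

section EvalLinearForms

variable {W ι : Type*} [NormedAddCommGroup W] [NormedSpace ℝ W]

lemma eval_forms_mem_polynomialFunctions (y : ι → W →L[ℝ] ℝ) (q : MvPolynomial ι ℝ) :
    (fun w => MvPolynomial.eval (fun j => y j w) q) ∈ polynomialFunctions W := by
  induction q using MvPolynomial.induction_on with
  | C a =>
    simp only [MvPolynomial.eval_C]
    exact (polynomialFunctions W).algebraMap_mem a
  | add p q hp hq =>
    simp only [map_add]
    exact add_mem hp hq
  | mul_X p i hp =>
    simp only [map_mul, MvPolynomial.eval_X]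
    exact mul_mem hp (dual_mem_polynomialFunctions (y i).toLinearMap)

lemma hasFDerivAt_eval_forms [Fintype ι] (y : ι → W →L[ℝ] ℝ) (q : MvPolynomial ι ℝ) (w : W) :
    HasFDerivAt (fun w => MvPolynomial.eval (fun j => y j w) q)
      (∑ j, MvPolynomial.eval (fun j => y j w) (MvPolynomial.pderiv j q) • y j) w := by
  classical
  induction q using MvPolynomial.induction_on with
  | C a => simpa using hasFDerivAt_const a w
  | add p q hp hq =>
    simp only [map_add, add_smul, Finset.sum_add_distrib]
    exact hp.add hq
  | mul_X p i hp =>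
    simp only [map_mul, MvPolynomial.eval_X]
    refine (hp.mul (y i).hasFDerivAt).congr_fderiv ?_
    simp only [Derivation.leibniz, smul_eq_mul, MvPolynomial.pderiv_X, map_add, map_mul,
      MvPolynomial.eval_X, add_smul, Finset.sum_add_distrib, Finset.smul_sum, smul_smul]
    congr 1
    rw [Finset.sum_eq_single i]
    · simp
    · intro j _ hj
      simp [hj.symm]
    · simp

/-- Dual families of vectors and linear forms are not degenerate after a small linear
perturbation. -/
lemma eventually_eq_zero_of_sum_eq_zero [Fintype ι] [DecidableEq ι] {u : ι → W}
    {y : ι → W →L[ℝ] ℝ} (hy : ∀ i j, y j (u i) = if j = i then 1 else 0) :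
    ∀ᶠ a in nhds (1 : W →L[ℝ] W), ∀ c : ι → ℝ, (∀ i, ∑ j, c j * y j (a (u i)) = 0) → c = 0 := by
  let M : (W →L[ℝ] W) → Matrix ι ι ℝ := fun a => Matrix.of fun i j => y j (a (u i))
  have hM : Continuous fun a => (M a).det := by
    refine Continuous.matrix_det (continuous_matrix fun i j => ?_)
    exact (y j).continuous.comp (ContinuousLinearMap.apply ℝ W (u i)).continuous
  have h1 : (M 1).det ≠ 0 := by
    have : M 1 = 1 := by
      ext i j
      simp [M, hy, Matrix.one_apply, eq_comm]
    rw [this, Matrix.det_one]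
    exact one_ne_zero
  filter_upwards [hM.continuousAt.eventually_ne h1] with a ha c hc
  refine Matrix.eq_zero_of_mulVec_eq_zero ha (funext fun i => ?_)
  simpa [Matrix.mulVec, dotProduct, M, mul_comm] using hc i

end EvalLinearForms

/-! ### Derivations of the coordinate ring of a group -/

section CoordinateRing

open Filter Topology

variable {A : Type*} [NormedRing A] [NormedAlgebra ℝ A] {G : Subgroup Aˣ}

/-- Restriction of polynomial functions on `A` to `G`. -/
noncomputable def restrictToGroup (G : Subgroup Aˣ) :
    polynomialFunctions A →ₐ[ℝ] (G → ℝ) :=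
  (AlgHom.pi
    fun g : G => Pi.evalAlgHom ℝ (fun _ : A => ℝ) (g : Aˣ)).comp
    (polynomialFunctions A).val

variable [FiniteDimensional ℝ A]
  (hG : ∀ᶠ x in 𝓝[zariskiClosure (Units.val '' (G : Set Aˣ))] (1 : A),
    x ∈ Units.val '' (G : Set Aˣ))

include hG in
lemma isDomain_range_restrictToGroup [PreconnectedSpace G] :
    IsDomain (restrictToGroup G).range := by
  have : NoZeroDivisors (restrictToGroup G).range := by
    refine ⟨?_⟩
    rintro ⟨_, f₁, rfl⟩ ⟨_, f₂, rfl⟩ h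
    have h' : ∀ g : G, f₁.1 (g : Aˣ) * f₂.1 (g : Aˣ) = 0 := fun g =>
      congrFun (congrArg Subtype.val h) g
    refine (eq_zero_or_eq_zero_of_mul_eq_zero hG f₁.2 f₂.2 h').imp (fun h => ?_) fun h => ?_
    · exact Subtype.ext (funext h)
    · exact Subtype.ext (funext h)
  have : Nontrivial (restrictToGroup G).range :=
    ⟨0, 1, fun h => zero_ne_one (congrFun (congrArg Subtype.val h) (1 : G))⟩
  exact NoZeroDivisors.to_isDomain _

include hG in
/-- Linear forms on `A` that are algebraically independent on `G` are linearly independent on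
some tangent space of `G`. Dual derivations of the function field of `G` become, after clearing
denominators, polynomial vector fields on `A` that are tangent to `G`. -/
lemma exists_dual_tangent_vectors [PreconnectedSpace G] {ι : Type*} [Fintype ι] [DecidableEq ι]
    (η : ι → A →L[ℝ] ℝ)
    (hη : ∀ q : MvPolynomial ι ℝ,
      (∀ g : G, MvPolynomial.eval (fun j => η j (g : Aˣ)) q = 0) → q = 0) :
    ∃ g ∈ G, ∃ c : ℝ, c ≠ 0 ∧ ∃ ξ : ι → A,
      (∀ i, ξ i ∈ zariskiTangent (Units.val '' (G : Set Aˣ)) (g : A)) ∧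
      ∀ i j, η j (ξ i) = if j = i then c else 0 := by
  set ρ := (restrictToGroup G).rangeRestrict
  have := isDomain_range_restrictToGroup hG
  have : Algebra.FiniteType ℝ (restrictToGroup G).range :=
    .of_surjective ρ (restrictToGroup G).rangeRestrict_surjective
  have : CharZero (restrictToGroup G).range :=
    charZero_of_injective_algebraMap (algebraMap ℝ (restrictToGroup G).range).injective
  let form : (A →L[ℝ] ℝ) → polynomialFunctions A := fun φ =>
    ⟨fun a => φ a, dual_mem_polynomialFunctions φ.toLinearMap⟩
  have hind : AlgebraicIndependent ℝ fun i => ρ (form (η i)) := by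
    rw [algebraicIndependent_iff]
    intro q hq
    refine hη q fun g => ?_
    let ev : (restrictToGroup G).range →ₐ[ℝ] ℝ :=
      (Pi.evalAlgHom ℝ (fun _ : G => ℝ) g).comp (restrictToGroup G).range.val
    have h := MvPolynomial.comp_aeval_apply (fun i => ρ (form (η i))) ev q
    rw [hq, map_zero] at h
    exact h.symm
  obtain ⟨c, hc, D, hD⟩ := exists_dual_derivations_of_domain hind
  let b := Module.finBasis ℝ A
  choose α hα using fun i k => (restrictToGroup G).rangeRestrict_surjective
    (D i (ρ (form (LinearMap.toContinuousLinearMap (b.coord k)))))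
  let ξ : ι → A → A := fun i a => ∑ k, (α i k).1 a • b k
  have hξ : ∀ i, ∀ φ : Module.Dual ℝ A,
      (fun a => φ (ξ i a)) = ∑ k, φ (b k) • (α i k).1 := by
    intro i φ
    ext a
    simp [ξ, mul_comm]
  have hξpoly : ∀ i, ∀ φ : Module.Dual ℝ A,
      (fun a => φ (ξ i a)) ∈ polynomialFunctions A := by
    intro i φ
    rw [hξ]
    exact Subalgebra.sum_mem _ fun k _ => Subalgebra.smul_mem _ (α i k).2 _
  -- the vector field `ξ i` represents the derivation `D i`
  have hmain : ∀ i f (hf : f ∈ polynomialFunctions A) (g : G),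
      (D i (ρ ⟨f, hf⟩)).1 g = fderiv ℝ f (g : Aˣ) (ξ i (g : Aˣ)) := by
    intro i f hf g
    induction hf using Algebra.adjoin_induction with
    | mem f hf =>
      obtain ⟨φ, rfl⟩ := hf
      have h1 : fderiv ℝ (fun a => φ a) ((g : Aˣ) : A) =
          LinearMap.toContinuousLinearMap φ := (LinearMap.toContinuousLinearMap φ).fderiv
      have h2 : (⟨fun a => φ a, dual_mem_polynomialFunctions φ⟩ :
          polynomialFunctions A) =
          ∑ k, φ (b k) • form (LinearMap.toContinuousLinearMap (b.coord k)) := by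
        ext a
        conv_lhs => rw [← b.sum_repr a]
        simp [form, Finset.sum_apply, mul_comm, -Module.Basis.sum_repr]
      rw [h1, LinearMap.coe_toContinuousLinearMap', congrFun (hξ i φ), h2]
      have h3 : ∀ k, (D i (ρ (form (LinearMap.toContinuousLinearMap (b.coord k))))).1 g =
          (α i k).1 (g : Aˣ) := fun k => by
        rw [← hα]
        rfl
      simp only [map_sum, map_smul]
      simp [Finset.sum_apply, h3]
    | algebraMap r =>
      have h1 : D i (ρ ⟨algebraMap ℝ (A → ℝ) r, Subalgebra.algebraMap_mem _ r⟩) = 0 :=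
        (D i).map_algebraMap r
      have h2 : fderiv ℝ (algebraMap ℝ (A → ℝ) r) ((g : Aˣ) : A) = 0 :=
        fderiv_const_apply r
      rw [h1, h2]
      rfl
    | add f₁ f₂ hf₁ hf₂ h₁ h₂ =>
      rw [fderiv_add (differentiableAt_of_mem_polynomialFunctions hf₁ _)
        (differentiableAt_of_mem_polynomialFunctions hf₂ _), _root_.add_apply, ← h₁, ← h₂]
      exact congrFun (congrArg Subtype.val ((D i).map_add (ρ ⟨f₁, hf₁⟩) (ρ ⟨f₂, hf₂⟩))) g
    | mul f₁ f₂ hf₁ hf₂ h₁ h₂ =>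
      rw [fderiv_mul (differentiableAt_of_mem_polynomialFunctions hf₁ _)
        (differentiableAt_of_mem_polynomialFunctions hf₂ _), _root_.add_apply, _root_.smul_apply,
        _root_.smul_apply, ← h₁, ← h₂]
      exact congrFun (congrArg Subtype.val ((D i).leibniz (ρ ⟨f₁, hf₁⟩) (ρ ⟨f₂, hf₂⟩))) g
  obtain ⟨g, hg⟩ : ∃ g : G, c.1 g ≠ 0 := by
    by_contra! h
    exact hc (Subtype.ext (funext h))
  refine ⟨g, g.2, c.1 g, hg, fun i => ξ i (g : Aˣ), fun i f hf hfG => ?_,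
    fun i j => ?_⟩
  · have h0 : ρ ⟨f, hf⟩ = 0 := Subtype.ext (funext fun x => hfG _ ⟨x, x.2, rfl⟩)
    rw [← hmain i f hf g, h0, map_zero]
    rfl
  · have h := hmain i _ (form (η j)).2 g
    have h1 : D i (ρ ⟨_, (form (η j)).2⟩) = if j = i then c else 0 := hD i j
    have h2 : fderiv ℝ (form (η j)).1 ((g : Aˣ) : A) = η j := (η j).fderiv
    rw [h1, h2] at h
    rw [← h]
    split_ifs <;> rfl

end CoordinateRing

/-! ### The tangent space of an orbit closure -/

section OrbitTangent

open Filter Topology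

variable {V : Type*} [NormedAddCommGroup V] [NormedSpace ℝ V] {G : Subgroup (V →L[ℝ] V)ˣ}

variable [FiniteDimensional ℝ V]

lemma map_mem_zariskiTangent_orbitSet {g : (V →L[ℝ] V)ˣ} (hg : g ∈ G) {v w u : V}
    (hu : u ∈ zariskiTangent (orbitSet (G : Set (V →L[ℝ] V)ˣ) v) w) :
    (g : V →L[ℝ] V) u ∈ zariskiTangent (orbitSet (G : Set (V →L[ℝ] V)ˣ) v)
      ((g : V →L[ℝ] V) w) := by
  refine map_mem_zariskiTangent _ ?_ hu
  rintro _ ⟨h, hh, rfl⟩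
  exact ⟨g * h, G.mul_mem hg hh, rfl⟩

lemma lie_apply_mem_zariskiTangent_orbitSet (v : V) {X : V →L[ℝ] V} (hX : X ∈ zariskiLie G) :
    X v ∈ zariskiTangent (orbitSet (G : Set (V →L[ℝ] V)ˣ) v) v := by
  have h := map_mem_zariskiTangent (S' := orbitSet (G : Set (V →L[ℝ] V)ˣ) v)
    (ContinuousLinearMap.apply ℝ V v) (S := Units.val '' (G : Set (V →L[ℝ] V)ˣ)) ?_ hX
  · simpa using h
  · rintro _ ⟨g, hg, rfl⟩
    exact ⟨g, hg, rfl⟩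

variable (hG : ∀ᶠ x in 𝓝[zariskiClosure (Units.val '' (G : Set (V →L[ℝ] V)ˣ))] (1 : V →L[ℝ] V),
  x ∈ Units.val '' (G : Set (V →L[ℝ] V)ˣ))

include hG in
/-- Linear forms that are dual to vectors of the Zariski tangent space at `v` are algebraically
independent as functions on the orbit of `v`: the partial derivatives of a relation of minimal
degree would be relations as well. -/
lemma eq_zero_of_eval_forms_eq_zero [PreconnectedSpace G] {ι : Type*} [Fintype ι] [DecidableEq ι]
    {v : V} {u : ι → V} {y : ι → V →L[ℝ] ℝ}
    (hu : ∀ i, u i ∈ zariskiTangent (orbitSet (G : Set (V →L[ℝ] V)ˣ) v) v)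
    (hy : ∀ i j, y j (u i) = if j = i then 1 else 0)
    (q : MvPolynomial ι ℝ)
    (hq : ∀ g : G, MvPolynomial.eval (fun j => y j (((g : (V →L[ℝ] V)ˣ) : V →L[ℝ] V) v)) q = 0) :
    q = 0 := by
  induction hn : q.totalDegree using Nat.strong_induction_on generalizing q with
  | _ n ih =>
  subst hn
  have hconst : q.totalDegree = 0 := by
    by_contra hdeg
    refine hdeg (totalDegree_eq_zero_of_pderiv_eq_zero fun j =>
      ih _ (totalDegree_pderiv_lt j hdeg) _ (fun g => ?_) rfl)
    refine eq_zero_of_eventually_eq_zero hG (g := 1) (f := fun a =>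
      MvPolynomial.eval (fun j => y j (a v)) (MvPolynomial.pderiv j q)) ?_ ?_ g
    · exact comp_linear_mem_polynomialFunctions (ContinuousLinearMap.apply ℝ V v).toLinearMap
        (eval_forms_mem_polynomialFunctions y _)
    -- near `1` the forms `y j ∘ g` stay independent on the span of the `u i`
    have hcont : Tendsto (fun g : G => ((g : (V →L[ℝ] V)ˣ) : V →L[ℝ] V)) (𝓝 1) (𝓝 1) :=
      Continuous.tendsto' (Units.continuous_val.comp continuous_subtype_val) _ _ rfl
    filter_upwards [hcont.eventually (eventually_eq_zero_of_sum_eq_zero hy)] with g hg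
    refine congrFun (hg (fun j =>
      MvPolynomial.eval (fun j => y j (((g : (V →L[ℝ] V)ˣ) : V →L[ℝ] V) v))
        (MvPolynomial.pderiv j q)) fun i => ?_) j
    have h := map_mem_zariskiTangent_orbitSet g.2 (hu i) _
      (eval_forms_mem_polynomialFunctions y q) ?_
    · rw [(hasFDerivAt_eval_forms y q _).fderiv] at h
      simpa using h
    · rintro _ ⟨k, hk, rfl⟩
      exact hq ⟨k, hk⟩
  rw [MvPolynomial.totalDegree_eq_zero_iff_eq_C] at hconst
  rw [hconst] at hq ⊢
  have h := hq 1
  rw [MvPolynomial.eval_C] at h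
  rw [h, map_zero]

include hG in
/-- The Zariski tangent space of the closure of the orbit of `v` is the space of all `X v`, with
`X` in the Lie algebra: in characteristic zero the orbit map is generically smooth, and by
homogeneity generic points are as good as `v`. -/
lemma exists_lie_apply_eq [PreconnectedSpace G] {v u : V}
    (hu : u ∈ zariskiTangent (orbitSet (G : Set (V →L[ℝ] V)ˣ) v) v) :
    ∃ X ∈ zariskiLie G, X v = u := by
  set T := zariskiTangent (orbitSet (G : Set (V →L[ℝ] V)ˣ) v) v with hT
  obtain ⟨T', hT'⟩ := T.exists_isCompl
  let b := Module.finBasis ℝ T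
  let y : Fin (Module.finrank ℝ T) → V →L[ℝ] ℝ := fun j =>
    LinearMap.toContinuousLinearMap ((b.coord j).comp (T.projectionOnto T' hT'))
  have hy : ∀ i j, y j (b i) = if j = i then 1 else 0 := by
    intro i j
    have h : y j (b i) = b.coord j (T.projectionOnto T' hT' (b i)) := rfl
    rw [h, Submodule.projectionOnto_apply_left, Module.Basis.coord_apply, Module.Basis.repr_self,
      Finsupp.single_apply]
    simp [eq_comm]
  obtain ⟨g, hg, c, hc, ξ, hξ, hξy⟩ := exists_dual_tangent_vectors hG
    (fun j => (y j).comp (ContinuousLinearMap.apply ℝ V v)) fun q hq =>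
      eq_zero_of_eval_forms_eq_zero hG (fun i => (b i).2) hy q hq
  let N : Submodule ℝ V := (zariskiLie G).map (ContinuousLinearMap.apply ℝ V v).toLinearMap
  have hNT : N ≤ T := by
    rintro _ ⟨X, hX, rfl⟩
    exact lie_apply_mem_zariskiTangent_orbitSet v hX
  let Λ : V →ₗ[ℝ] Fin (Module.finrank ℝ T) → ℝ :=
    LinearMap.pi fun j => ((y j).comp (g : V →L[ℝ] V)).toLinearMap
  have hΛ : Function.Surjective (Λ.comp N.subtype) := by
    rw [← LinearMap.range_eq_top, eq_top_iff, ← (Pi.basisFun ℝ _).span_eq, Submodule.span_le]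
    rintro _ ⟨i, rfl⟩
    -- translating the tangent vectors at `g` back to `1` gives elements of the Lie algebra
    have hX : ((g⁻¹ : (V →L[ℝ] V)ˣ) : V →L[ℝ] V) * ξ i ∈ zariskiLie G := by
      simpa using mul_mem_zariskiTangent (G.inv_mem hg) (hξ i)
    refine ⟨c⁻¹ • ⟨_, _, hX, rfl⟩, ?_⟩
    rw [map_smul]
    ext j
    have h1 : (g : V →L[ℝ] V) ((((g⁻¹ : (V →L[ℝ] V)ˣ) : V →L[ℝ] V) * ξ i) v) = ξ i v := by
      rw [← mul_apply_eq_comp, Units.mul_inv_cancel_left]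
    change c⁻¹ * y j ((g : V →L[ℝ] V) ((((g⁻¹ : (V →L[ℝ] V)ˣ) : V →L[ℝ] V) * ξ i) v)) = _
    have h2 : y j (ξ i v) = if j = i then c else 0 := hξy i j
    rw [h1, h2, Pi.basisFun_apply, Pi.single_apply]
    split_ifs <;> simp [hc]
  have hdim := LinearMap.finrank_le_finrank_of_surjective hΛ
  rw [Module.finrank_fin_fun] at hdim
  have hNT' := Submodule.eq_of_le_of_finrank_le hNT hdim
  obtain ⟨X, hX, rfl⟩ : u ∈ N := hNT' ▸ hu
  exact ⟨X, hX, rfl⟩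

include hG in
/-- A connected group that is open in its Zariski closure has orbits that are open in their
Zariski closures. -/
lemma orbitSet_mem_nhdsWithin [PreconnectedSpace G] (v : V) :
    orbitSet (G : Set (V →L[ℝ] V)ˣ) v ∈
      𝓝[zariskiClosure (orbitSet (G : Set (V →L[ℝ] V)ˣ) v)] v := by
  have : CompleteSpace (zariskiLie G) := FiniteDimensional.complete ℝ _
  have hψ := (ContinuousLinearMap.apply ℝ V v).hasStrictFDerivAt.comp (0 : zariskiLie G)
    (hasStrictFDerivAt_exp_subtype (zariskiLie G))
  have hev : ∀ᶠ X : zariskiLie G in 𝓝 0,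
      NormedSpace.exp (X : V →L[ℝ] V) v ∈ orbitSet (G : Set (V →L[ℝ] V)ˣ) v := by
    filter_upwards [eventually_exp_mem hG] with X ⟨g, hg, hgX⟩
    exact ⟨g, hg, by rw [hgX]⟩
  refine nhdsWithin_zariskiClosure_le_map hψ (by simp)
    (hev.mono fun X hX => subset_zariskiClosure _ hX) (fun u hu => ?_) hev
  obtain ⟨X, hX, rfl⟩ := exists_lie_apply_eq hG hu
  exact ⟨⟨X, hX⟩, rfl⟩

end OrbitTangent

/-! ### The Zariski closure of a group -/

section ZariskiGroup

open Filter Topology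

variable {A : Type*} [NormedRing A] [NormedAlgebra ℝ A] [FiniteDimensional ℝ A]

/-- The Zariski closure of a group of units, as a group of units. -/
def zariskiGroup (G : Subgroup Aˣ) : Subgroup Aˣ where
  carrier := {g | (g : A) ∈ zariskiClosure (Units.val '' (G : Set Aˣ))}
  one_mem' := subset_zariskiClosure _ ⟨1, G.one_mem, rfl⟩
  mul_mem' {g h} hg hh := by
    refine mapsTo_zariskiClosure (LinearMap.mulRight ℝ (h : A)) ?_ hg
    rintro _ ⟨k, hk, rfl⟩
    refine mapsTo_zariskiClosure (LinearMap.mulLeft ℝ (k : A)) ?_ hh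
    rintro _ ⟨l, hl, rfl⟩
    exact subset_zariskiClosure _ ⟨k * l, G.mul_mem hk hl, rfl⟩
  inv_mem' {g} hg := by
    have h : ∀ s ∈ Units.val '' (G : Set Aˣ), g.mulLeftLinearEquiv ℝ A s ∈
        zariskiClosure (Units.val '' (G : Set Aˣ)) := by
      rintro _ ⟨k, hk, rfl⟩
      refine mapsTo_zariskiClosure (LinearMap.mulRight ℝ (k : A)) ?_ hg
      rintro _ ⟨l, hl, rfl⟩
      exact subset_zariskiClosure _ ⟨l * k, G.mul_mem hl hk, rfl⟩
    have h1 := symm_mem_zariskiClosure (g.mulLeftLinearEquiv ℝ A) h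
      (subset_zariskiClosure _ ⟨1, G.one_mem, rfl⟩)
    have h2 : (g.mulLeftLinearEquiv ℝ A).symm ((1 : Aˣ) : A) = ((g⁻¹ : Aˣ) : A) := by
      rw [LinearEquiv.symm_apply_eq]
      exact g.mul_inv.symm
    rwa [h2] at h1

lemma le_zariskiGroup (G : Subgroup Aˣ) : G ≤ zariskiGroup G :=
  fun g hg => subset_zariskiClosure _ ⟨g, hg, rfl⟩

/-- A connected group that is open in its Zariski closure is normalized by it: it is the identity
component. -/
lemma conj_mem_of_mem_zariskiGroup {G : Subgroup Aˣ} [PreconnectedSpace G]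
    (hG : IsOpen (G.subgroupOf (zariskiGroup G) : Set (zariskiGroup G))) {g h : Aˣ} (hg : g ∈ G)
    (hh : h ∈ zariskiGroup G) : h * g * h⁻¹ ∈ G := by
  have : CompleteSpace A := FiniteDimensional.complete ℝ A
  let c : G → zariskiGroup G := fun x => ⟨h, hh⟩ * ⟨x, le_zariskiGroup G x.2⟩ * ⟨h, hh⟩⁻¹
  have hc : Continuous c :=
    (continuous_const.mul (continuous_subtype_val.subtype_mk _)).mul continuous_const
  have hclopen : IsClopen (c ⁻¹' (G.subgroupOf (zariskiGroup G) : Set (zariskiGroup G))) :=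
    IsClopen.preimage ⟨Subgroup.isClosed_of_isOpen _ hG, hG⟩ hc
  have h1 : c 1 = 1 := by
    change (⟨h, hh⟩ * 1 * ⟨h, hh⟩⁻¹ : zariskiGroup G) = 1
    group
  have hmem : (⟨g, hg⟩ : G) ∈ c ⁻¹' (G.subgroupOf (zariskiGroup G) : Set (zariskiGroup G)) := by
    rw [hclopen.eq_univ ⟨1, by rw [Set.mem_preimage, h1]; exact one_mem _⟩]
    trivial
  exact hmem

lemma eventually_mem_of_isOpen {G : Subgroup Aˣ}
    (hG : IsOpen (G.subgroupOf (zariskiGroup G) : Set (zariskiGroup G))) :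
    ∀ᶠ x in 𝓝[zariskiClosure (Units.val '' (G : Set Aˣ))] (1 : A),
      x ∈ Units.val '' (G : Set Aˣ) := by
  have : CompleteSpace A := FiniteDimensional.complete ℝ A
  obtain ⟨O, hO, hOG⟩ := isOpen_induced_iff.1 hG
  have hmem : ∀ z : zariskiGroup G, (z : Aˣ) ∈ O ↔ (z : Aˣ) ∈ G := fun z => Set.ext_iff.1 hOG z
  have hO1 : Units.val '' O ∈ 𝓝 (1 : A) :=
    (Units.isOpenEmbedding_val.isOpenMap O hO).mem_nhds
      ⟨1, (hmem 1).2 G.one_mem, rfl⟩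
  filter_upwards [self_mem_nhdsWithin, nhdsWithin_le_nhds hO1]
  rintro _ hx ⟨z, hz, rfl⟩
  exact ⟨z, (hmem ⟨z, hx⟩).1 hz, rfl⟩

end ZariskiGroup

/-! ### Boundaries of orbits -/

section Boundary

open Filter Topology

variable {V : Type*} [NormedAddCommGroup V] [NormedSpace ℝ V] [FiniteDimensional ℝ V]

lemma zariskiClosureGL_eq (G : Subgroup (V →L[ℝ] V)ˣ) :
    zariskiClosureGL (G : Set (V →L[ℝ] V)ˣ) = zariskiGroup G := by
  ext g
  constructor
  · intro hg
    exact hg _ ⟨⟨_, isZariskiClosed_zariskiClosure (Units.val '' (G : Set (V →L[ℝ] V)ˣ)), rfl⟩,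
      le_zariskiGroup G⟩
  · rintro hg _ ⟨⟨Y, hY, rfl⟩, hGY⟩
    refine hg Y ⟨hY, ?_⟩
    rintro _ ⟨k, hk, rfl⟩
    exact hGY hk

/-- The Zariski closure of an orbit of `G` is stable under the Zariski closure of `G`. -/
lemma apply_mem_zariskiClosure_orbitSet {G : Subgroup (V →L[ℝ] V)ˣ} {h : (V →L[ℝ] V)ˣ}
    (hh : h ∈ zariskiGroup G) {v w : V}
    (hw : w ∈ zariskiClosure (orbitSet (G : Set (V →L[ℝ] V)ˣ) v)) :
    (h : V →L[ℝ] V) w ∈ zariskiClosure (orbitSet (G : Set (V →L[ℝ] V)ˣ) v) := by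
  refine mapsTo_zariskiClosure (h : V →L[ℝ] V).toLinearMap ?_ hw
  rintro _ ⟨k, hk, rfl⟩
  have h1 : h * k ∈ zariskiGroup G := mul_mem hh (le_zariskiGroup G hk)
  refine mapsTo_zariskiClosure (ContinuousLinearMap.apply ℝ V v).toLinearMap ?_ h1
  rintro _ ⟨l, hl, rfl⟩
  exact subset_zariskiClosure _ ⟨l, hl, rfl⟩

/-- A point of the orbit of `v` under the Zariski closure of `G` that is a limit of points of `G v`
belongs to `G v`. -/
lemma apply_mem_orbitSet_of_mem_closure {G : Subgroup (V →L[ℝ] V)ˣ} [PreconnectedSpace G]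
    (hG : IsOpen (G.subgroupOf (zariskiGroup G) : Set (zariskiGroup G)))
    {h : (V →L[ℝ] V)ˣ} (hh : h ∈ zariskiGroup G) {v : V}
    (hv : (h : V →L[ℝ] V) v ∈ closure (orbitSet (G : Set (V →L[ℝ] V)ˣ) v)) :
    (h : V →L[ℝ] V) v ∈ orbitSet (G : Set (V →L[ℝ] V)ˣ) v := by
  have hinv : ∀ w, ((h⁻¹ : (V →L[ℝ] V)ˣ) : V →L[ℝ] V) ((h : V →L[ℝ] V) w) = w := fun w => by
    rw [← mul_apply_eq_comp, Units.inv_mul]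
    rfl
  have hinv' : ∀ w, (h : V →L[ℝ] V) (((h⁻¹ : (V →L[ℝ] V)ˣ) : V →L[ℝ] V) w) = w := fun w => by
    rw [← mul_apply_eq_comp, Units.mul_inv]
    rfl
  -- `h` is a homeomorphism of the Zariski closure, so `h G v` is a neighbourhood of `h v` in it
  have hnhds : ∀ᶠ w in 𝓝[zariskiClosure (orbitSet (G : Set (V →L[ℝ] V)ˣ) v)] ((h : V →L[ℝ] V) v),
      ((h⁻¹ : (V →L[ℝ] V)ˣ) : V →L[ℝ] V) w ∈ orbitSet (G : Set (V →L[ℝ] V)ˣ) v := by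
    have ht : Tendsto ((h⁻¹ : (V →L[ℝ] V)ˣ) : V →L[ℝ] V)
        (𝓝[zariskiClosure (orbitSet (G : Set (V →L[ℝ] V)ˣ) v)] ((h : V →L[ℝ] V) v))
        (𝓝[zariskiClosure (orbitSet (G : Set (V →L[ℝ] V)ˣ) v)] v) := by
      refine tendsto_nhdsWithin_iff.2 ⟨?_, ?_⟩
      · refine (Continuous.tendsto' (ContinuousLinearMap.continuous _) _ _ (hinv v)).mono_left
          nhdsWithin_le_nhds
      · filter_upwards [self_mem_nhdsWithin] with w hw
        exact apply_mem_zariskiClosure_orbitSet (inv_mem hh) hw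
    exact ht.eventually (orbitSet_mem_nhdsWithin (eventually_mem_of_isOpen hG) v)
  have hfreq := (mem_closure_iff_frequently.1 hv).and_eventually
    (eventually_nhdsWithin_iff.1 hnhds)
  obtain ⟨w, hw, hw'⟩ := hfreq.exists
  obtain ⟨g, hg, hgw⟩ := hw' (subset_zariskiClosure _ hw)
  obtain ⟨k, hk, rfl⟩ := hw
  refine ⟨(h * g * h⁻¹)⁻¹ * k,
    mul_mem (inv_mem (conj_mem_of_mem_zariskiGroup hG hg hh)) hk, ?_⟩
  have hkv : (k : V →L[ℝ] V) v = (h : V →L[ℝ] V) ((g : V →L[ℝ] V) v) := by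
    rw [← hgw, hinv']
  change _ = (((h * g * h⁻¹)⁻¹ : (V →L[ℝ] V)ˣ) : V →L[ℝ] V) ((k : V →L[ℝ] V) v)
  rw [hkv]
  change _ = ((((h * g * h⁻¹)⁻¹ * h * g : (V →L[ℝ] V)ˣ)) : V →L[ℝ] V) v
  congr 2
  group

end Boundary

end RealZariski

theorem lemma6p1 {V : Type*} [NormedAddCommGroup V] [NormedSpace ℝ V] [FiniteDimensional ℝ V]
    (G : Subgroup (V →L[ℝ] V)ˣ)
    (hconn : IsConnected (G : Set (V →L[ℝ] V)ˣ))
    (hopen : IsOpen {z : RealZariski.zariskiClosureGL (G : Set (V →L[ℝ] V)ˣ) | (z : (V →L[ℝ] V)ˣ) ∈ G})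
    (v : V) :
    RealZariski.zariskiBoundary G v ∩ closure (RealZariski.orbitSet (G : Set (V →L[ℝ] V)ˣ) v)
        = RealZariski.metricBoundary G v ∧
      RealZariski.metricBoundary G v ⊆ RealZariski.zariskiBoundary G v ∧
      RealZariski.zariskiBoundary G v ∩ RealZariski.orbitSet (G : Set (V →L[ℝ] V)ˣ) v = ∅ ∧
      RealZariski.metricBoundary G v ∩
        RealZariski.orbitSet (RealZariski.zariskiClosureGL (G : Set (V →L[ℝ] V)ˣ)) v = ∅ := by
  have : PreconnectedSpace G := Subtype.preconnectedSpace hconn.isPreconnected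
  rw [RealZariski.zariskiClosureGL_eq] at hopen ⊢
  have hkey : ∀ w ∈ RealZariski.metricBoundary G v,
      w ∉ RealZariski.orbitSet (RealZariski.zariskiGroup G : Set (V →L[ℝ] V)ˣ) v := by
    rintro _ ⟨hw, hwG⟩ ⟨h, hh, rfl⟩
    exact hwG (RealZariski.apply_mem_orbitSet_of_mem_closure hopen hh hw)
  have hsub : RealZariski.orbitSet (G : Set (V →L[ℝ] V)ˣ) v ⊆
      RealZariski.orbitSet (RealZariski.zariskiGroup G : Set (V →L[ℝ] V)ˣ) v := by
    rintro _ ⟨g, hg, rfl⟩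
    exact ⟨g, RealZariski.le_zariskiGroup G hg, rfl⟩
  have hZ : RealZariski.zariskiBoundary G v =
      RealZariski.zariskiClosure (RealZariski.orbitSet (G : Set (V →L[ℝ] V)ˣ) v) \
        RealZariski.orbitSet (RealZariski.zariskiGroup G : Set (V →L[ℝ] V)ˣ) v := by
    rw [RealZariski.zariskiBoundary, RealZariski.zariskiClosureGL_eq]
  have hle : RealZariski.metricBoundary G v ⊆ RealZariski.zariskiBoundary G v := fun w hw => by
    rw [hZ]
    exact ⟨closure_minimal (RealZariski.subset_zariskiClosure _)
      (RealZariski.isClosed_zariskiClosure _) hw.1, hkey w hw⟩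
  refine ⟨Set.Subset.antisymm ?_ fun w hw => ⟨hle hw, hw.1⟩, hle, ?_, ?_⟩
  · rw [hZ]
    exact fun w hw => ⟨hw.2, fun h => hw.1.2 (hsub h)⟩
  · rw [hZ, Set.eq_empty_iff_forall_notMem]
    exact fun w hw => hw.1.2 (hsub hw.2)
  · rw [Set.eq_empty_iff_forall_notMem]
    exact fun w hw => hkey w hw.1 hw.2
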